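/- Let $n\in\mathbb N$ and $[n]=\{1,\dots,n\}$. The $n$-cube $Q_n$ has as vertices the subsets of $[n]$, with $X$ and $Y$ joined by an edge of direction $i$ if their symmetric difference is $X\oplus Y=\{i\}$. For $i\in[n]$ let $\sigma_i$ be the automorphism $X\mapsto X\oplus\{i\}$ of $Q_n$. The signature of a spanning tree $T$ of $Q_n$ is $\operatorname{sig}(T)=(a_1,\dots,a_n)$, where $a_i$ is the number of edges of $T$ in direction $i$. For a nonempty proper subset $R$ of $[n]$, the tuple $(a_1,\dots,a_n)$ and the tree $T$ are said to reduce over $R$ if $\sum_{i\in R}a_i=2^{|R|}-1$; let $\mathrm{Red}(R)$ be the set of signatures of spanning trees of $Q_n$ that reduce over $R$. Write $\bar R=[n]\setminus R$. The multigraph $Q_n/\bar R$ is obtained from $Q_n$ by contracting every edge in a direction not in $R$: its vertices are the subsets of $R$, and each edge $\{U,V\}$ of $Q_n$ in a direction in $R$ gives an edge of $Q_n/\bar R$ joining $U\cap R$ and $V\cap R$, which keeps its direction (distinct edges of $Q_n$ give distinct edges, so there are $2^{n-|R|}$ parallel edges for each edge of the cube on the subsets of $R$). The maps $\sigma_i$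 act on these edges as they do on the edges of $Q_n$. For a spanning tree $T$ of $Q_n$, $T/\bar R$ is the subgraph of $Q_n/\bar R$ with all its vertices and with the edges of $T$ in directions in $R$. For $X\subseteq R$ and a subgraph $H$ of $Q_n$, $H(R,X)$ is the subgraph of $H$ induced by its vertices $W$ with $W\cap R=X$. Let $G$ be one of $Q_n$, $Q_n/\bar R$, $Q_n(R,X)$. The edge slide graph $\mathcal E(G)$ has as vertices the spanning trees of $G$. Two of them, $T_1$ and $T_2$, are adjacent if $T_2=T_1-e+\sigma_i(e)$ for some edge $e$ of $T_1$ and some $i\in[n]$ different from the direction of $e$ such that $\sigma_i(e)$ is not an edge of $T_1$. For a signature $\mathcal S$, $\mathcal E(\mathcal S)$ is the subgraph of $\mathcal E(Q_n)$ induced by the spanning trees with signature $\mathcal S$, and $\mathcal E(\mathrm{Red}(R))=\bigcup_{\mathcal S\in\mathrm{Red}(R)}\mathcal E(\mathcal S)$; its vertices are the spanning trees of $Q_n$ that reduce over $R$. Let $\square$ be the Cartesian product of graphs: two vertices are adjacent if they are adjacent in one coordinate and equal in all the others. **Theorem.** Let $R$ be a proper nonempty subset of $[n]$ and let $r=|R|$.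 Then $$\mathcal E(\mathrm{Red}(R))\;\cong\;\mathcal E(Q_n/\bar R)\;\square\;\mathop{\square}_{X\subseteq R}\mathcal E(Q_n(R,X))\;\cong\;\mathcal E(Q_n/\bar R)\;\square\;\mathcal E(Q_{n-r})^{\square\, 2^r},$$ where the first isomorphism is given by $T\mapsto\bigl(T/\bar R,\,(T(R,X))_{X\subseteq R}\bigr)$. In particular, for a spanning tree $T$ of $Q_n$ that reduces over $R$, the graphs $T/\bar R$ and $T(R,X)$ are spanning trees of $Q_n/\bar R$ and $Q_n(R,X)$. -/

import Mathlib

open scoped symmDiff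

namespace EdgeSlide

/-! ### Generalities on graphs -/

/-- A (multi)graph is a tree if it has no loops and no parallel edges, and the simple graph which
it then amounts to is a tree (connected and without cycles). -/
def IsTree {α β : Type*} (T : Graph α β) : Prop :=
  T.Simple ∧ T.toSimpleGraph.IsTree

/-- `T` is a spanning tree of the (multi)graph `G`. -/
def IsSpanningTree {α β : Type*} (G T : Graph α β) : Prop :=
  T.IsSpanningSubgraph G ∧ IsTree T

/-- The type of spanning trees of `G`. -/
abbrev SpanningTree {α β : Type*} (G : Graph α β) : Type _ :=
  {T : Graph α β // IsSpanningTree G T}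

/-- The Cartesian product of a family of simple graphs: two families of vertices are adjacent if
they are adjacent in one coordinate and agree in all the other coordinates.
(The Cartesian product of two graphs is Mathlib's `SimpleGraph.boxProd`.) -/
def boxPi {ι : Type*} {V : ι → Type*} (G : ∀ i, SimpleGraph (V i)) :
    SimpleGraph (∀ i, V i) where
  Adj f g := ∃ i, (G i).Adj (f i) (g i) ∧ ∀ k, k ≠ i → f k = g k
  symm := ⟨fun _ _ ⟨i, h, h'⟩ => ⟨i, h.symm, fun k hk => (h' k hk).symm⟩⟩
  loopless := ⟨fun _ ⟨i, h, _⟩ => (G i).irrefl h⟩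

/-! ### The cube

The set `[n]` is `Fin n`, and its subsets are the elements of `Finset (Fin n)`. -/

/-- The `n`-cube as a simple graph: `X` and `Y` are adjacent if they differ by adding or removing
exactly one element. -/
def cubeGraph (n : ℕ) : SimpleGraph (Finset (Fin n)) where
  Adj X Y := ∃ i, X ∆ Y = {i}
  symm := ⟨fun X Y ⟨i, h⟩ => ⟨i, by rw [symmDiff_comm, h]⟩⟩
  loopless := ⟨fun X ⟨i, h⟩ => by simp at h⟩

/-- The `n`-cube `Q_n`; its edges are unordered pairs of subsets of `[n]`. -/
def cube (n : ℕ) : Graph (Finset (Fin n)) (Sym2 (Finset (Fin n))) :=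
  Graph.ofSimpleGraph (cubeGraph n)

variable {n : ℕ}

/-- The edge `e` of the cube is in direction `i`: `e = {X, X ∆ {i}}` for some `X`. -/
def HasDirection (e : Sym2 (Finset (Fin n))) (i : Fin n) : Prop :=
  ∃ X : Finset (Fin n), e = s(X, X ∆ {i})

/-- The action on edges of the automorphism `σ_i : X ↦ X ∆ {i}` of the cube. -/
def slide (i : Fin n) (e : Sym2 (Finset (Fin n))) : Sym2 (Finset (Fin n)) :=
  e.map (fun X => X ∆ {i})

theorem slide_slide (i : Fin n) (e : Sym2 (Finset (Fin n))) : slide i (slide i e) = e := by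
  induction e with
  | h X Y => simp [slide]

theorem HasDirection.slide {e : Sym2 (Finset (Fin n))} {j : Fin n} (h : HasDirection e j)
    (i : Fin n) : HasDirection (slide i e) j := by
  obtain ⟨X, rfl⟩ := h
  exact ⟨X ∆ {i}, by simp [EdgeSlide.slide, symmDiff_right_comm]⟩

/-! ### Edge slides

`Q_n`, its induced subgraphs and its contractions are all treated as (multi)graphs with edges in
`Sym2 (Finset (Fin n))`: an edge of a contraction is an edge of `Q_n` that is not contracted. So
`HasDirection` and `slide` apply to all of them. -/

/-- `T₂` is obtained from `T₁` by sliding an edge `e` in some direction `j` in a direction `i ≠ j`,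
that is `σ_i(e)` is not in `T₁` and `T₂ = T₁ - e + σ_i(e)`. Between spanning trees of one graph,
which are determined by their sets of edges. -/
def IsEdgeSlide (T₁ T₂ : Graph (Finset (Fin n)) (Sym2 (Finset (Fin n)))) : Prop :=
  ∃ (e : Sym2 (Finset (Fin n))) (i j : Fin n), e ∈ T₁.edgeSet ∧ HasDirection e j ∧ i ≠ j ∧
    slide i e ∉ T₁.edgeSet ∧ T₂.edgeSet = insert (slide i e) (T₁.edgeSet \ {e})

theorem IsEdgeSlide.symm {T₁ T₂ : Graph (Finset (Fin n)) (Sym2 (Finset (Fin n)))}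
    (h : IsEdgeSlide T₁ T₂) : IsEdgeSlide T₂ T₁ := by
  obtain ⟨e, i, j, he, hj, hij, hs, hT⟩ := h
  have hne : e ≠ EdgeSlide.slide i e := fun h => hs (h ▸ he)
  refine ⟨EdgeSlide.slide i e, i, j, ?_, hj.slide i, hij, ?_, ?_⟩
  · simp [hT]
  · simp [hT, slide_slide, hne]
  · rw [hT, slide_slide]
    ext f
    simp only [Set.mem_insert_iff, Set.mem_sdiff, Set.mem_singleton_iff]
    constructor
    · intro hf
      by_cases hfe : f = e
      · exact Or.inl hfe
      · exact Or.inr ⟨Or.inr ⟨hf, hfe⟩, fun h => hs (h ▸ hf)⟩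
    · rintro (rfl | ⟨h | h, h'⟩)
      · exact he
      · exact absurd h h'
      · exact h.1

/-- The edge slide graph of `G`, where `G` is `Q_n`, an induced subgraph of it or a contraction of
it: the vertices are the spanning trees of `G`, and two of them are adjacent if one may be obtained
from the other by a single edge slide. -/
def edgeSlideGraph (G : Graph (Finset (Fin n)) (Sym2 (Finset (Fin n)))) :
    SimpleGraph (SpanningTree G) where
  Adj T₁ T₂ := IsEdgeSlide T₁.1 T₂.1
  symm := ⟨fun _ _ h => h.symm⟩
  loopless := ⟨fun T ⟨e, i, j, _, _, _, hs, hT⟩ => hs (by rw [hT]; exact Set.mem_insert _ _)⟩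

/-! ### Signatures and reducibility -/

/-- The signature of `T`: its `i`-th entry is the number of edges of `T` in direction `i`. -/
noncomputable def signature (T : Graph (Finset (Fin n)) (Sym2 (Finset (Fin n)))) : Fin n → ℕ :=
  fun i => {e | e ∈ T.edgeSet ∧ HasDirection e i}.ncard

/-- The set of signatures of spanning trees of `Q_n`. -/
def signatures (n : ℕ) : Set (Fin n → ℕ) :=
  {S | ∃ T : SpanningTree (cube n), signature T.1 = S}

/-- The tuple `S` reduces over the set `R` of directions. -/
def ReducesOver (S : Fin n → ℕ) (R : Finset (Fin n)) : Prop :=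
  ∑ i ∈ R, S i = 2 ^ R.card - 1

/-- `Red(R)`: the signatures of `Q_n` that reduce over `R`. -/
def red (R : Finset (Fin n)) : Set (Fin n → ℕ) :=
  {S | S ∈ signatures n ∧ ReducesOver S R}

/-- The edge slide graph of the signature `S`: the subgraph of the edge slide graph of `Q_n`
induced by the spanning trees with signature `S`. -/
def edgeSlideSig (S : Fin n → ℕ) : (edgeSlideGraph (cube n)).Subgraph :=
  (⊤ : (edgeSlideGraph (cube n)).Subgraph).induce {T | signature T.1 = S}

/-- The union of the edge slide graphs of the signatures in `𝒳`. -/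
def edgeSlideSigs (𝒳 : Set (Fin n → ℕ)) : (edgeSlideGraph (cube n)).Subgraph :=
  ⨆ S ∈ 𝒳, edgeSlideSig S

/-! ### Parts and contractions -/

/-- `H(R, X)`: the subgraph of `H` induced by the vertices `W` of `H` with `W ∩ R = X`. -/
def part (H : Graph (Finset (Fin n)) (Sym2 (Finset (Fin n)))) (R X : Finset (Fin n)) :
    Graph (Finset (Fin n)) (Sym2 (Finset (Fin n))) :=
  H.induce {W | W ∈ H.vertexSet ∧ W ∩ R = X}

/-- `H / S`, for a subgraph `H` of `Q_n`: the multigraph that results from `H` when all edges of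
`Q_n` in directions belonging to `S` are contracted. Two vertices `U`, `V` of `Q_n` become equal if
and only if `U \ S = V \ S`, and the vertex that they become is labelled by this set; every edge of
`H` in a direction not in `S` remains, as an edge between the images of its ends, possibly with
several edges between the same two vertices. -/
def contract (H : Graph (Finset (Fin n)) (Sym2 (Finset (Fin n)))) (S : Finset (Fin n)) :
    Graph (Finset (Fin n)) (Sym2 (Finset (Fin n))) :=
  (H.map (fun U => U \ S)).deleteEdges {e | ∃ j ∈ S, HasDirection e j}

end EdgeSlide

open EdgeSlide

namespace EdgeSlide

/-! The edges of `Q_n` split into disjoint blocks: those with direction in `R`, which are the edges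
of the contraction, and for each `X ⊆ R` those with both ends over `X`. A spanning tree has `2 ^ n -
1` edges, and it reduces over `R` exactly when `2 ^ r - 1` of them lie in the first block.

The contraction of such a tree is connected on `2 ^ r` vertices, hence a tree. Every part is
connected too: if one were split in two, the `2 ^ r - 1` edges with direction in `R` would have to
connect `2 ^ r + 1` classes of vertices (`IsConn.part`). The edge count then leaves each part just
enough edges to be a tree (`isTree_part`). Conversely, arbitrary trees in the blocks glue to a
reducing spanning tree (`isTree_of_contract_of_part`), so `decompose` is bijective.

A slide keeps the direction of the edge, hence the signature. Since all reducing trees have equally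
many edges in a given block, a slide between two of them cannot carry an edge to another block; it
is a slide inside one block that fixes the others (`isEdgeSlide_iff_exists_block`), which is
adjacency in the Cartesian product. For the second isomorphism, each part is a translated copy of
`Q_{n-r}`, embedded by `subcube`. -/

theorem ncard_eq_sum_of_partition {ι β : Type*} [Fintype ι] [Finite β] {s : Set β} {t : ι → Set β}
    (h : ∀ e, e ∈ s ↔ ∃ i, e ∈ t i) (hd : ∀ i j e, e ∈ t i → e ∈ t j → i = j) :
    s.ncard = ∑ i, (t i).ncard := by
  have hs : s = ⋃ i, t i := by ext e; simp [h]
  rw [hs, Set.ncard_iUnion_of_finite (fun i => Set.toFinite _), finsum_eq_sum_of_fintype]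
  exact fun i j hij => Set.disjoint_left.2 fun e hi hj => hij (hd i j e hi hj)

/-! ### Trees in multigraphs by connectivity and edge counts -/

section Graph

variable {α β γ : Type*}

/-- Every property of vertices that is preserved along the edges of `T` holds for all or for none
of the vertices of `T`. -/
def IsConn (T : Graph α β) : Prop :=
  ∀ P : α → Prop, (∀ e x y, T.IsLink e x y → P x → P y) →
    ∀ x ∈ T.vertexSet, ∀ y ∈ T.vertexSet, P x → P y

/-- Connectivity in terms of predicates needs no walks: it passes to quotients and subcubes by
composing the predicate with a map. -/
theorem connected_toSimpleGraph_iff (T : Graph α β) :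
    T.toSimpleGraph.Connected ↔ T.vertexSet.Nonempty ∧ IsConn T := by
  constructor
  · intro h
    refine ⟨Set.nonempty_coe_sort.1 h.nonempty, fun P hP x hx y hy hPx => ?_⟩
    obtain ⟨w⟩ := h.preconnected ⟨x, hx⟩ ⟨y, hy⟩
    have key : ∀ u v : T.vertexSet, T.toSimpleGraph.Walk u v → P u → P v := by
      intro u v w
      induction w with
      | nil => exact id
      | cons hadj _ ih =>
        intro hu
        obtain ⟨e, he⟩ := hadj.2
        exact ih (hP e _ _ he hu)
    exact key _ _ w hPx
  · rintro ⟨⟨v, hv⟩, h⟩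
    have : Nonempty T.vertexSet := ⟨⟨v, hv⟩⟩
    refine SimpleGraph.Connected.mk fun x y => ?_
    have := h (fun z => ∃ hz : z ∈ T.vertexSet, T.toSimpleGraph.Reachable x ⟨z, hz⟩) ?_
      x x.2 y y.2 ⟨x.2, SimpleGraph.Reachable.refl _⟩
    · exact this.2
    · rintro e a b hab ⟨ha, hr⟩
      refine ⟨hab.right_mem, ?_⟩
      by_cases hne : a = b
      · subst hne; exact hr
      · exact hr.trans (SimpleGraph.Adj.reachable ⟨fun h => hne (congrArg Subtype.val h), e, hab⟩)

/-- The pair of ends of an edge. -/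
noncomputable def ends (T : Graph α β) (e : T.edgeSet) : Sym2 T.vertexSet :=
  s(⟨_, (T.exists_isLink_of_mem_edgeSet e.2).choose_spec.choose_spec.left_mem⟩,
    ⟨_, (T.exists_isLink_of_mem_edgeSet e.2).choose_spec.choose_spec.right_mem⟩)

theorem ends_eq_iff {T : Graph α β} {e : T.edgeSet} {x y : T.vertexSet} :
    ends T e = s(x, y) ↔ T.IsLink e x y := by
  rw [(T.exists_isLink_of_mem_edgeSet e.2).choose_spec.choose_spec.isLink_iff, ends, Sym2.eq_iff]
  simp only [Subtype.ext_iff]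

theorem edgeSet_toSimpleGraph (T : Graph α β) :
    T.toSimpleGraph.edgeSet = Set.range (ends T) ∩ {p | ¬ p.IsDiag} := by
  ext p
  induction p with
  | h x y =>
    simp only [SimpleGraph.mem_edgeSet, Set.mem_inter_iff, Set.mem_range, Set.mem_ofPred_eq,
      Sym2.mk_isDiag_iff, ends_eq_iff, Graph.toSimpleGraph_adj]
    exact ⟨fun ⟨h, e, he⟩ => ⟨⟨⟨e, he.edge_mem⟩, he⟩, h⟩, fun ⟨⟨e, he⟩, h⟩ => ⟨h, e, he⟩⟩

theorem ncard_toSimpleGraph_le [Finite α] [Finite β] (T : Graph α β) :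
    T.toSimpleGraph.edgeSet.ncard ≤ T.edgeSet.ncard := by
  rw [edgeSet_toSimpleGraph]
  calc _ ≤ (Set.range (ends T)).ncard := Set.ncard_le_ncard Set.inter_subset_left (Set.toFinite _)
    _ ≤ _ := by
      rw [← Set.image_univ, ← Nat.card_coe_set_eq T.edgeSet, ← Set.ncard_univ]
      exact Set.ncard_image_le (Set.toFinite _)

theorem IsConn.ncard_vertexSet_le [Finite α] [Finite β] {T : Graph α β} (h : IsConn T) :
    T.vertexSet.ncard ≤ T.edgeSet.ncard + 1 := by
  rcases T.vertexSet.eq_empty_or_nonempty with h0 | h0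
  · simp [h0]
  · have := ((connected_toSimpleGraph_iff T).2 ⟨h0, h⟩).card_vert_le_card_edgeSet_add_one
    rw [Nat.card_coe_set_eq, Nat.card_coe_set_eq] at this
    exact this.trans (Nat.add_le_add_right (ncard_toSimpleGraph_le T) 1)

/-- The edges of `T.toSimpleGraph` are the non-diagonal values of `ends`. Their number reaches that
of the edges of `T` exactly when no value is diagonal (no loops) and `ends` is injective (no
parallel edges). -/
theorem simple_iff_ncard [Finite α] [Finite β] (T : Graph α β) :
    T.Simple ↔ T.toSimpleGraph.edgeSet.ncard = T.edgeSet.ncard := by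
  rw [edgeSet_toSimpleGraph]
  have hcard : T.edgeSet.ncard = (Set.univ : Set T.edgeSet).ncard := by
    rw [Set.ncard_univ, Nat.card_coe_set_eq]
  constructor
  · intro hT
    have h1 : Set.range (ends T) ∩ {p | ¬ p.IsDiag} = Set.range (ends T) := by
      rw [Set.inter_eq_left]
      rintro _ ⟨e, rfl⟩
      obtain ⟨x, y, hxy⟩ := T.exists_isLink_of_mem_edgeSet e.2
      have : ends T e = s(⟨x, hxy.left_mem⟩, ⟨y, hxy.right_mem⟩) := ends_eq_iff.2 hxy
      simp [this, hxy.ne]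
    rw [h1, hcard, ← Set.image_univ, Set.ncard_image_of_injective]
    intro e f hef
    obtain ⟨x, y, hxy⟩ := T.exists_isLink_of_mem_edgeSet e.2
    have he : ends T e = s(⟨x, hxy.left_mem⟩, ⟨y, hxy.right_mem⟩) := ends_eq_iff.2 hxy
    rw [hef] at he
    exact Subtype.ext (hxy.eq (ends_eq_iff.1 he))
  · intro h
    have h1 : (Set.range (ends T)).ncard ≤ T.edgeSet.ncard := by
      rw [hcard, ← Set.image_univ]
      exact Set.ncard_image_le (Set.toFinite _)
    have h2 : Set.range (ends T) ∩ {p | ¬ p.IsDiag} = Set.range (ends T) :=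
      Set.eq_of_subset_of_ncard_le Set.inter_subset_left (h1.trans h.ge) (Set.toFinite _)
    have hinj : Set.InjOn (ends T) Set.univ := by
      refine Set.injOn_of_ncard_image_eq ?_ (Set.toFinite _)
      rw [Set.image_univ, ← hcard, ← h, h2]
    refine { not_isLoopAt := fun e x hx => ?_, eq_of_isLink := fun e f x y he hf => ?_ }
    · have hm : ends T ⟨e, hx.edge_mem⟩ ∈ Set.range (ends T) ∩ {p | ¬ p.IsDiag} :=
        by rw [h2]; exact ⟨_, rfl⟩
      have he : ends T ⟨e, hx.edge_mem⟩ = s(⟨x, hx.vertex_mem⟩, ⟨x, hx.vertex_mem⟩) :=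
        ends_eq_iff.2 hx
      rw [he] at hm
      exact hm.2 (by simp)
    · have he' : ends T ⟨e, he.edge_mem⟩ = s(⟨x, he.left_mem⟩, ⟨y, he.right_mem⟩) :=
        ends_eq_iff.2 he
      have hf' : ends T ⟨f, hf.edge_mem⟩ = s(⟨x, he.left_mem⟩, ⟨y, he.right_mem⟩) :=
        ends_eq_iff.2 hf
      exact congrArg Subtype.val (hinj (Set.mem_univ _) (Set.mem_univ _) (he'.trans hf'.symm))

/-- Simplicity comes for free: a connected multigraph with one edge fewer than vertices has none to
waste on loops or parallel edges. -/
theorem isTree_iff [Finite α] [Finite β] (T : Graph α β) :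
    IsTree T ↔ T.vertexSet.Nonempty ∧ IsConn T ∧ T.edgeSet.ncard + 1 = T.vertexSet.ncard := by
  rw [IsTree, SimpleGraph.isTree_iff_connected_and_card, connected_toSimpleGraph_iff,
    simple_iff_ncard, Nat.card_coe_set_eq, Nat.card_coe_set_eq]
  constructor
  · rintro ⟨h, ⟨h1, h2⟩, h3⟩
    exact ⟨h1, h2, h ▸ h3⟩
  · rintro ⟨h1, h2, h3⟩
    have hle := ncard_toSimpleGraph_le T
    have hge := ((connected_toSimpleGraph_iff T).2 ⟨h1, h2⟩).card_vert_le_card_edgeSet_add_one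
    rw [Nat.card_coe_set_eq, Nat.card_coe_set_eq] at hge
    have : T.toSimpleGraph.edgeSet.ncard = T.edgeSet.ncard := by omega
    exact ⟨this, ⟨h1, h2⟩, this ▸ h3⟩

/-- Identifying vertices with equal `φ` leaves a connected graph, and it stays connected when the
edges that became loops are deleted. -/
theorem IsConn.ncard_image_le [Finite α] [Finite β] [Finite γ] {T : Graph α β} (h : IsConn T)
    (φ : α → γ) :
    (φ '' T.vertexSet).ncard ≤ {e | ∃ x y, T.IsLink e x y ∧ φ x ≠ φ y}.ncard + 1 := by
  set D : Set β := {e | ∃ x y, T.IsLink e x y ∧ φ x ≠ φ y}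
  have hconn : IsConn ((T.map φ).restrict D) := by
    rintro P hP _ ⟨x, hx, rfl⟩ _ ⟨y, hy, rfl⟩
    refine h (fun z => P (φ z)) (fun e a b hab ha => ?_) x hx y hy
    by_cases hne : φ a = φ b
    · exact hne ▸ ha
    · exact hP e _ _ ⟨⟨a, b, hab, hne⟩, hab.map φ⟩ ha
  refine hconn.ncard_vertexSet_le.trans (Nat.add_le_add_right ?_ 1)
  exact Set.ncard_le_ncard Set.inter_subset_right (Set.toFinite _)

theorem eq_of_isSpanningSubgraph {G H₁ H₂ : Graph α β} (h₁ : H₁.IsSpanningSubgraph G)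
    (h₂ : H₂.IsSpanningSubgraph G) (h : H₁.edgeSet = H₂.edgeSet) : H₁ = H₂ :=
  Graph.Compatible.ext (h₁.vertexSet_eq.trans h₂.vertexSet_eq.symm) h
    (Graph.Compatible.of_le_le h₁.le h₂.le)

theorem SpanningTree.ext_edgeSet {G : Graph α β} {T₁ T₂ : SpanningTree G}
    (h : T₁.1.edgeSet = T₂.1.edgeSet) : T₁ = T₂ :=
  Subtype.ext <| eq_of_isSpanningSubgraph T₁.2.1 T₂.2.1 h

theorem restrict_isSpanningSubgraph (G : Graph α β) (F : Set β) :
    (G.restrict F).IsSpanningSubgraph G :=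
  ⟨Graph.restrict_le, rfl⟩

theorem IsSpanningTree.isLink_iff {G T : Graph α β} (hT : IsSpanningTree G T) {e : β} {x y : α} :
    T.IsLink e x y ↔ e ∈ T.edgeSet ∧ G.IsLink e x y :=
  ⟨fun h => ⟨h.edge_mem, h.mono hT.1.le⟩, fun h => (hT.1.le.isLink_iff h.1).2 h.2⟩

end Graph

/-! ### Blocks of the cube: the contraction and the parts -/

section Cube

variable {n : ℕ}

theorem cube_isLink {e : Sym2 (Finset (Fin n))} {x y : Finset (Fin n)} :
    (cube n).IsLink e x y ↔ e = s(x, y) ∧ ∃ i, x ∆ y = {i} := by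
  simp only [cube, Graph.ofSimpleGraph_isLink]
  constructor
  · rintro ⟨rfl, h⟩
    exact ⟨rfl, h⟩
  · rintro ⟨rfl, h⟩
    exact ⟨rfl, h⟩

theorem vertexSet_cube : (cube n).vertexSet = Set.univ := rfl

theorem hasDirection_mk {x y : Finset (Fin n)} {i : Fin n} :
    HasDirection s(x, y) i ↔ x ∆ y = {i} := by
  constructor
  · rintro ⟨X, h⟩
    rcases Sym2.eq_iff.1 h with ⟨rfl, rfl⟩ | ⟨rfl, rfl⟩
    · simp
    · simp [symmDiff_comm]
  · intro h
    exact ⟨x, by rw [← h]; simp⟩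

theorem HasDirection.unique {e : Sym2 (Finset (Fin n))} {i j : Fin n} (hi : HasDirection e i)
    (hj : HasDirection e j) : i = j := by
  induction e with
  | h x y =>
    rw [hasDirection_mk] at hi hj
    exact Finset.singleton_injective (hi.symm.trans hj)

theorem mem_edgeSet_cube {e : Sym2 (Finset (Fin n))} :
    e ∈ (cube n).edgeSet ↔ ∃ j, HasDirection e j := by
  rw [Graph.edge_mem_iff_exists_isLink]
  constructor
  · rintro ⟨x, y, h⟩
    obtain ⟨rfl, i, hi⟩ := cube_isLink.1 h
    exact ⟨i, hasDirection_mk.2 hi⟩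
  · rintro ⟨j, X, rfl⟩
    exact ⟨_, _, cube_isLink.2 ⟨rfl, j, by simp⟩⟩

theorem sdiff_compl_eq_inter (R U : Finset (Fin n)) : U \ Rᶜ = U ∩ R := by
  ext i; simp

theorem inter_eq_iff_of_symmDiff {x y R : Finset (Fin n)} {i : Fin n} (h : x ∆ y = {i}) :
    x ∩ R = y ∩ R ↔ i ∉ R := by
  have hi : ∀ k, (k ∈ x ↔ k ∈ y) ↔ k ≠ i := by
    intro k
    have := congrArg (k ∈ ·) h
    simp only [Finset.mem_symmDiff, Finset.mem_singleton, eq_iff_iff] at this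
    tauto
  simp only [Finset.ext_iff, Finset.mem_inter]
  constructor
  · intro hk hiR
    have := hk i
    have := hi i
    tauto
  · intro hiR k
    by_cases hki : k = i
    · subst hki; simp [hiR]
    · have := (hi k).2 hki
      tauto

/-- Whether an edge of the cube has a direction in `R` can be read off from its ends. -/
theorem exists_hasDirection_iff {e : Sym2 (Finset (Fin n))} {x y R : Finset (Fin n)}
    (h : (cube n).IsLink e x y) : (∃ j ∈ R, HasDirection e j) ↔ x ∩ R ≠ y ∩ R := by
  obtain ⟨rfl, i, hi⟩ := cube_isLink.1 h
  rw [Ne, inter_eq_iff_of_symmDiff hi, not_not]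
  constructor
  · rintro ⟨j, hj, h⟩
    exact (hasDirection_mk.2 hi).unique h ▸ hj
  · exact fun h => ⟨i, h, hasDirection_mk.2 hi⟩

theorem not_exists_hasDirection_compl_iff {e : Sym2 (Finset (Fin n))} (R : Finset (Fin n))
    (he : e ∈ (cube n).edgeSet) :
    (¬ ∃ j ∈ Rᶜ, HasDirection e j) ↔ ∃ j ∈ R, HasDirection e j := by
  obtain ⟨i, hi⟩ := mem_edgeSet_cube.1 he
  constructor
  · intro h
    refine ⟨i, ?_, hi⟩
    by_contra hiR
    exact h ⟨i, by simpa using hiR, hi⟩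
  · rintro ⟨j, hj, hj'⟩ ⟨k, hk, hk'⟩
    obtain rfl := hj'.unique hk'
    simp [hj] at hk

variable {T : Graph (Finset (Fin n)) (Sym2 (Finset (Fin n)))}

theorem edgeSet_contract (hT : T ≤ cube n) (R : Finset (Fin n)) :
    (contract T Rᶜ).edgeSet = {e | e ∈ T.edgeSet ∧ ∃ j ∈ R, HasDirection e j} := by
  ext e
  simp only [contract, Graph.edgeSet_deleteEdges, Graph.edgeSet_map, Set.mem_sdiff]
  exact and_congr_right fun he => not_exists_hasDirection_compl_iff R (hT.edgeSet_mono he)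

theorem vertexSet_contract (hT : T.vertexSet = Set.univ) (R : Finset (Fin n)) :
    (contract T Rᶜ).vertexSet = {X | X ⊆ R} := by
  ext X
  simp only [contract, Graph.vertexSet_deleteEdges, Graph.vertexSet_map, hT, Set.image_univ,
    Set.mem_range, sdiff_compl_eq_inter]
  exact ⟨fun ⟨y, hy⟩ => hy ▸ Finset.inter_subset_right,
    fun h => ⟨X, Finset.inter_eq_left.2 h⟩⟩

theorem contract_isLink (hT : T ≤ cube n) {R : Finset (Fin n)} {e : Sym2 (Finset (Fin n))}
    {x y : Finset (Fin n)} :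
    (contract T Rᶜ).IsLink e x y ↔
      ∃ u v, T.IsLink e u v ∧ u ∩ R = x ∧ v ∩ R = y ∧ x ≠ y := by
  simp only [contract, Graph.deleteEdges_isLink, Graph.map_isLink, Relation.Map,
    sdiff_compl_eq_inter]
  constructor
  · rintro ⟨⟨u, v, h, rfl, rfl⟩, hd⟩
    refine ⟨u, v, h, rfl, rfl, ?_⟩
    exact (exists_hasDirection_iff (h.mono hT)).1
      ((not_exists_hasDirection_compl_iff R (hT.edgeSet_mono h.edge_mem)).1 hd)
  · rintro ⟨u, v, h, rfl, rfl, hne⟩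
    exact ⟨⟨u, v, h, rfl, rfl⟩, (not_exists_hasDirection_compl_iff R
      (hT.edgeSet_mono h.edge_mem)).2 ((exists_hasDirection_iff (h.mono hT)).2 hne)⟩

theorem contract_isSpanningSubgraph (hT : T.IsSpanningSubgraph (cube n)) (R : Finset (Fin n)) :
    (contract T Rᶜ).IsSpanningSubgraph (contract (cube n) Rᶜ) :=
  ⟨Graph.deleteEdges_mono_left (hT.le.map _) _, by
    rw [vertexSet_contract hT.vertexSet_eq, vertexSet_contract rfl]⟩

theorem vertexSet_part (hT : T.vertexSet = Set.univ) (R X : Finset (Fin n)) :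
    (part T R X).vertexSet = {W | W ∩ R = X} := by
  simp [part, hT]

theorem part_isLink {R X : Finset (Fin n)} {e : Sym2 (Finset (Fin n))} {x y : Finset (Fin n)} :
    (part T R X).IsLink e x y ↔ T.IsLink e x y ∧ x ∩ R = X ∧ y ∩ R = X := by
  simp only [part, Graph.induce_isLink]
  exact ⟨fun ⟨h, h1, h2⟩ => ⟨h, h1.2, h2.2⟩,
    fun ⟨h, h1, h2⟩ => ⟨h, ⟨h.left_mem, h1⟩, ⟨h.right_mem, h2⟩⟩⟩

theorem part_isSpanningSubgraph (hT : T.IsSpanningSubgraph (cube n)) (R X : Finset (Fin n)) :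
    (part T R X).IsSpanningSubgraph (part (cube n) R X) := by
  have hV : (part T R X).vertexSet = (part (cube n) R X).vertexSet := by
    rw [vertexSet_part hT.vertexSet_eq, vertexSet_part rfl]
  refine ⟨⟨hV.subset, fun e x y h => ?_⟩, hV⟩
  rw [part_isLink] at h ⊢
  exact ⟨h.1.mono hT.le, h.2⟩

theorem edgeSet_part (hT : T ≤ cube n) (R X : Finset (Fin n)) :
    (part T R X).edgeSet = T.edgeSet ∩ (part (cube n) R X).edgeSet := by
  ext e
  simp only [Set.mem_inter_iff, Graph.edge_mem_iff_exists_isLink, part_isLink]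
  constructor
  · rintro ⟨x, y, h, h'⟩
    exact ⟨⟨x, y, h⟩, x, y, h.mono hT, h'⟩
  · rintro ⟨⟨x, y, h⟩, x', y', h', h''⟩
    exact ⟨x', y', (hT.isLink_iff h.edge_mem).2 h', h''⟩

theorem edgeSet_contract_eq_inter (hT : T ≤ cube n) (R : Finset (Fin n)) :
    (contract T Rᶜ).edgeSet = T.edgeSet ∩ (contract (cube n) Rᶜ).edgeSet := by
  rw [edgeSet_contract hT, edgeSet_contract le_rfl]
  ext e
  exact ⟨fun h => ⟨h.1, hT.edgeSet_mono h.1, h.2⟩, fun h => ⟨h.1, h.2.2⟩⟩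

theorem edgeSet_part_subset (R X : Finset (Fin n)) :
    (part (cube n) R X).edgeSet ⊆ (cube n).edgeSet :=
  (edgeSet_part le_rfl R X).trans_subset Set.inter_subset_left

theorem edgeSet_contract_subset (R : Finset (Fin n)) :
    (contract (cube n) Rᶜ).edgeSet ⊆ (cube n).edgeSet :=
  (edgeSet_contract_eq_inter le_rfl R).trans_subset Set.inter_subset_left

theorem mem_part_unique {R X Y : Finset (Fin n)} {e : Sym2 (Finset (Fin n))}
    (hX : e ∈ (part (cube n) R X).edgeSet) (hY : e ∈ (part (cube n) R Y).edgeSet) : X = Y := by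
  obtain ⟨x, y, h⟩ := Graph.exists_isLink_of_mem_edgeSet hX
  obtain ⟨x', y', h'⟩ := Graph.exists_isLink_of_mem_edgeSet hY
  rw [part_isLink] at h h'
  rcases h.1.left_eq_or_eq h'.1 with rfl | rfl
  · rw [← h.2.1, ← h'.2.1]
  · rw [← h.2.1, ← h'.2.2]

theorem notMem_contract_of_mem_part {R X : Finset (Fin n)} {e : Sym2 (Finset (Fin n))}
    (hX : e ∈ (part (cube n) R X).edgeSet) : e ∉ (contract (cube n) Rᶜ).edgeSet := by
  intro h
  obtain ⟨x, y, hxy⟩ := Graph.exists_isLink_of_mem_edgeSet hX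
  rw [part_isLink] at hxy
  rw [edgeSet_contract le_rfl] at h
  exact (exists_hasDirection_iff hxy.1).1 h.2 (hxy.2.1.trans hxy.2.2.symm)

theorem mem_contract_or_part (R : Finset (Fin n)) {e : Sym2 (Finset (Fin n))}
    (he : e ∈ (cube n).edgeSet) :
    e ∈ (contract (cube n) Rᶜ).edgeSet ∨
      ∃ X : {X : Finset (Fin n) // X ⊆ R}, e ∈ (part (cube n) R X.1).edgeSet := by
  obtain ⟨x, y, hxy⟩ := Graph.exists_isLink_of_mem_edgeSet he
  by_cases h : x ∩ R = y ∩ R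
  · exact Or.inr ⟨⟨x ∩ R, Finset.inter_subset_right⟩,
      (part_isLink.2 ⟨hxy, rfl, h.symm⟩ : (part (cube n) R (x ∩ R)).IsLink e x y).edge_mem⟩
  · exact Or.inl (by rw [edgeSet_contract le_rfl]; exact ⟨he, (exists_hasDirection_iff hxy).2 h⟩)

/-- Each edge has only one direction, so the direction classes over `R` partition the edges of the
contraction. -/
theorem sum_signature (hT : T ≤ cube n) (R : Finset (Fin n)) :
    ∑ i ∈ R, signature T i = (contract T Rᶜ).edgeSet.ncard := by
  rw [edgeSet_contract hT, ← Finset.sum_coe_sort]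
  symm
  apply ncard_eq_sum_of_partition
  · intro e
    simp
  · rintro i j e ⟨_, hi⟩ ⟨_, hj⟩
    exact Subtype.ext (hi.unique hj)

/-- The edges of the cube that lie in the contraction (`none`) or in one of the parts. -/
def block (R : Finset (Fin n)) :
    Option {X : Finset (Fin n) // X ⊆ R} → Set (Sym2 (Finset (Fin n)))
  | none => (contract (cube n) Rᶜ).edgeSet
  | some X => (part (cube n) R X.1).edgeSet

theorem exists_mem_block (R : Finset (Fin n)) {e : Sym2 (Finset (Fin n))}
    (he : e ∈ (cube n).edgeSet) : ∃ o, e ∈ block R o :=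
  Option.exists.2 (mem_contract_or_part R he)

theorem block_unique {R : Finset (Fin n)} {e : Sym2 (Finset (Fin n))} :
    ∀ o o', e ∈ block R o → e ∈ block R o' → o = o'
  | none, none => fun _ _ => rfl
  | none, some _ => fun h1 h2 => absurd h1 (notMem_contract_of_mem_part h2)
  | some _, none => fun h2 h1 => absurd h1 (notMem_contract_of_mem_part h2)
  | some _, some _ => fun h1 h2 => congrArg some (Subtype.ext (mem_part_unique h1 h2))

theorem eq_iff_forall_block {A₁ A₂ : Set (Sym2 (Finset (Fin n)))} (R : Finset (Fin n))
    (h₁ : A₁ ⊆ (cube n).edgeSet) (h₂ : A₂ ⊆ (cube n).edgeSet) :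
    A₁ = A₂ ↔ ∀ o, A₁ ∩ block R o = A₂ ∩ block R o := by
  refine ⟨fun h o => h ▸ rfl, fun h => Set.ext fun e => ⟨fun he => ?_, fun he => ?_⟩⟩
  · obtain ⟨o, ho⟩ := exists_mem_block R (h₁ he)
    exact ((h o).subset ⟨he, ho⟩).1
  · obtain ⟨o, ho⟩ := exists_mem_block R (h₂ he)
    exact ((h o).superset ⟨he, ho⟩).1

theorem ncard_edgeSet (hT : T ≤ cube n) (R : Finset (Fin n)) :
    T.edgeSet.ncard = (contract T Rᶜ).edgeSet.ncard +
      ∑ X : {X : Finset (Fin n) // X ⊆ R}, (part T R X.1).edgeSet.ncard := by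
  rw [ncard_eq_sum_of_partition (t := fun o => T.edgeSet ∩ block R o) ?_
    fun o o' e h h' => block_unique o o' h.2 h'.2, Fintype.sum_option]
  · simp only [edgeSet_contract_eq_inter hT, edgeSet_part hT, block]
  · exact fun e => ⟨fun he => (exists_mem_block R (hT.edgeSet_mono he)).imp fun o ho => ⟨he, ho⟩,
      fun ⟨_, h⟩ => h.1⟩

theorem ncard_setOf_subset (R : Finset (Fin n)) :
    {X : Finset (Fin n) | X ⊆ R}.ncard = 2 ^ R.card := by
  have : {X : Finset (Fin n) | X ⊆ R} = (R.powerset : Set (Finset (Fin n))) := by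
    ext; simp
  rw [this, Set.ncard_coe_finset, Finset.card_powerset]

theorem card_subtype_subset (R : Finset (Fin n)) :
    Fintype.card {X : Finset (Fin n) // X ⊆ R} = 2 ^ R.card := by
  rw [← ncard_setOf_subset, ← Nat.card_eq_fintype_card]; rfl

theorem ncard_setOf_inter_eq {R X : Finset (Fin n)} (hX : X ⊆ R) :
    {W : Finset (Fin n) | W ∩ R = X}.ncard = 2 ^ (n - R.card) := by
  -- The fibre over `X` is the translate by `X` of the family of subsets of `Rᶜ`.
  have : {W : Finset (Fin n) | W ∩ R = X} = (fun W => X ∆ W) '' {W | W ⊆ Rᶜ} := by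
    ext W
    simp only [Set.mem_ofPred_eq, Set.mem_image]
    constructor
    · rintro rfl
      refine ⟨W \ R, ?_, ?_⟩
      · intro i; simp
      · ext i; simp only [Finset.mem_symmDiff, Finset.mem_inter, Finset.mem_sdiff]; tauto
    · rintro ⟨W, hW, rfl⟩
      ext i
      have h1 := @hX i
      have h2 := @hW i
      simp only [Finset.mem_symmDiff, Finset.mem_inter, Finset.mem_compl] at h2 ⊢
      tauto
  rw [this, Set.ncard_image_of_injective _ (symmDiff_right_injective X), ncard_setOf_subset,
    Finset.card_compl, Fintype.card_fin]

end Cube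

/-! ### Reducing trees, their contractions and parts, and gluing -/

section Decomposition

variable {n : ℕ} {T : Graph (Finset (Fin n)) (Sym2 (Finset (Fin n)))} {R : Finset (Fin n)}

theorem reducesOver_iff (hT : T ≤ cube n) :
    ReducesOver (signature T) R ↔ (contract T Rᶜ).edgeSet.ncard + 1 = 2 ^ R.card := by
  rw [ReducesOver, sum_signature hT]
  -- This makes the truncated subtraction in `ReducesOver` a genuine one.
  have := Nat.one_le_two_pow (n := R.card)
  omega

theorem IsConn.contract (h : IsConn T) (hT : T.IsSpanningSubgraph (cube n)) :
    IsConn (contract T Rᶜ) := by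
  intro P hP x hx y hy hPx
  rw [vertexSet_contract hT.vertexSet_eq] at hx hy
  have := h (fun W => P (W ∩ R)) (fun e u v huv hu => ?_) x (by simp [hT.vertexSet_eq, vertexSet_cube])
    y (by simp [hT.vertexSet_eq, vertexSet_cube])
  · rw [Finset.inter_eq_left.2 hx, Finset.inter_eq_left.2 hy] at this
    exact this hPx
  · by_cases hne : u ∩ R = v ∩ R
    · exact hne ▸ hu
    · exact hP e _ _ ((contract_isLink hT.le).2 ⟨u, v, huv, rfl, rfl, hne⟩) hu

/-- A part with a nontrivial splitting would leave too few edges in directions in `R` to connect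
the parts. -/
theorem IsConn.part (h : IsConn T) (hT : T.IsSpanningSubgraph (cube n))
    (hc : (EdgeSlide.contract T Rᶜ).edgeSet.ncard + 1 = 2 ^ R.card) {X : Finset (Fin n)} (hX : X ⊆ R) :
    IsConn (part T R X) := by
  intro P hP x hx y hy hPx
  by_contra hPy
  rw [vertexSet_part hT.vertexSet_eq] at hx hy
  -- The classes are the parts, with part `X` divided further according to `P`.
  have h1 := h.ncard_image_le (fun W => (W ∩ R, W ∩ R = X ∧ P W))
  have h2 : {e | ∃ u v, T.IsLink e u v ∧
      (u ∩ R, u ∩ R = X ∧ P u) ≠ (v ∩ R, v ∩ R = X ∧ P v)}.ncard ≤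
        (EdgeSlide.contract T Rᶜ).edgeSet.ncard := by
    refine Set.ncard_le_ncard ?_ (Set.toFinite _)
    rintro e ⟨u, v, huv, hne⟩
    rw [edgeSet_contract hT.le]
    refine ⟨huv.edge_mem, (exists_hasDirection_iff (huv.mono hT.le)).2 fun heq => hne ?_⟩
    -- Inside a part, `P` is constant along edges, so only an edge with direction in `R` can change
    -- the class.
    exact Prod.ext heq (propext
      ⟨fun ⟨a, b⟩ => ⟨heq ▸ a, hP e u v (part_isLink.2 ⟨huv, a, heq ▸ a⟩) b⟩,
        fun ⟨a, b⟩ => ⟨heq ▸ a, hP e v u (part_isLink.2 ⟨huv.symm, a, heq ▸ a⟩) b⟩⟩)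
  -- All `2 ^ r + 1` classes occur: `x` and `y` give the two halves of part `X`, and `Y` itself
  -- represents any other part.
  have h3 : insert (X, True) ((fun Y => (Y, False)) '' {Y | Y ⊆ R}) ⊆
      (fun W => (W ∩ R, W ∩ R = X ∧ P W)) '' T.vertexSet := by
    rw [hT.vertexSet_eq, vertexSet_cube, Set.image_univ]
    rintro _ (rfl | ⟨Y, hY, rfl⟩)
    · exact ⟨x, Prod.ext hx (by simpa using ⟨hx, hPx⟩)⟩
    · by_cases hYX : Y = X
      · subst hYX
        exact ⟨y, Prod.ext hy (by simp [hPy])⟩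
      · have hYR : Y ∩ R = Y := Finset.inter_eq_left.2 hY
        exact ⟨Y, Prod.ext hYR (by simp [hYR, hYX])⟩
  have h4 := Set.ncard_le_ncard h3 (Set.toFinite _)
  rw [Set.ncard_insert_of_notMem (by simp), Set.ncard_image_of_injective _
    (fun a b hab => congrArg Prod.fst hab), ncard_setOf_subset] at h4
  omega

theorem isTree_contract (hT : IsSpanningTree (cube n) T)
    (hR : ReducesOver (signature T) R) : IsTree (contract T Rᶜ) := by
  rw [reducesOver_iff hT.1.le] at hR
  refine (isTree_iff _).2 ⟨⟨∅, ?_⟩, ((isTree_iff T).1 hT.2).2.1.contract hT.1, ?_⟩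
  · rw [vertexSet_contract hT.1.vertexSet_eq]; exact Finset.empty_subset R
  · rw [vertexSet_contract hT.1.vertexSet_eq, ncard_setOf_subset, hR]

theorem two_pow_mul_two_pow_sub (R : Finset (Fin n)) : 2 ^ R.card * 2 ^ (n - R.card) = 2 ^ n := by
  rw [← pow_add, Nat.add_sub_cancel' (by simpa using R.card_le_univ)]

/-- Connectivity bounds the number of edges of each part from below; the total over all parts
attains the sum of these bounds, so each bound is attained. -/
theorem isTree_part (hT : IsSpanningTree (cube n) T)
    (hR : ReducesOver (signature T) R) {X : Finset (Fin n)} (hX : X ⊆ R) :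
    IsTree (part T R X) := by
  rw [reducesOver_iff hT.1.le] at hR
  obtain ⟨-, hconn, hcard⟩ := (isTree_iff T).1 hT.2
  have hV : ∀ Y : {Y : Finset (Fin n) // Y ⊆ R},
      (part T R Y.1).vertexSet.ncard = 2 ^ (n - R.card) := fun Y => by
    rw [vertexSet_part hT.1.vertexSet_eq, ncard_setOf_inter_eq Y.2]
  have hle : ∀ Y ∈ (Finset.univ : Finset {Y : Finset (Fin n) // Y ⊆ R}),
      2 ^ (n - R.card) ≤ (part T R Y.1).edgeSet.ncard + 1 := fun Y _ => by
    rw [← hV Y]; exact (hconn.part hT.1 hR Y.2).ncard_vertexSet_le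
  have hsum : ∑ _Y : {Y : Finset (Fin n) // Y ⊆ R}, 2 ^ (n - R.card) =
      ∑ Y : {Y : Finset (Fin n) // Y ⊆ R}, ((part T R Y.1).edgeSet.ncard + 1) := by
    rw [Finset.sum_add_distrib, Finset.sum_const, Finset.sum_const, Finset.card_univ,
      card_subtype_subset, smul_eq_mul, smul_eq_mul, two_pow_mul_two_pow_sub]
    have := ncard_edgeSet hT.1.le R
    rw [hT.1.vertexSet_eq, vertexSet_cube, Set.ncard_univ, Nat.card_eq_fintype_card,
      Fintype.card_finset, Fintype.card_fin] at hcard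
    omega
  refine (isTree_iff _).2 ⟨⟨X, ?_⟩, hconn.part hT.1 hR hX, ?_⟩
  · rw [vertexSet_part hT.1.vertexSet_eq]; exact Finset.inter_eq_left.2 hX
  · rw [hV ⟨X, hX⟩, ← (Finset.sum_eq_sum_iff_of_le hle).1 hsum ⟨X, hX⟩ (Finset.mem_univ _)]

/-- Gluing: `T` is a spanning tree that reduces over `R` if its contraction and its parts are
trees. -/
theorem isTree_of_contract_of_part (hT : T.IsSpanningSubgraph (cube n))
    (hc : IsTree (contract T Rᶜ)) (hp : ∀ X ⊆ R, IsTree (part T R X)) :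
    IsTree T ∧ ReducesOver (signature T) R := by
  obtain ⟨-, hcconn, hccard⟩ := (isTree_iff _).1 hc
  rw [vertexSet_contract hT.vertexSet_eq, ncard_setOf_subset] at hccard
  refine ⟨(isTree_iff _).2 ⟨⟨∅, by simp [hT.vertexSet_eq, vertexSet_cube]⟩, ?_, ?_⟩,
    (reducesOver_iff hT.le).2 hccard⟩
  · intro P hP x _ y _ hPx
    -- Connected parts make `P` depend only on `u ∩ R`, so it descends to the contraction, where `u
    -- ∩ R` serves as representative of its part.
    have hpart : ∀ u v, u ∩ R = v ∩ R → P u → P v := by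
      intro u v huv
      refine ((isTree_iff _).1 (hp (u ∩ R) Finset.inter_subset_right)).2.1 P
        (fun e a b hab => hP e a b (part_isLink.1 hab).1) u ?_ v ?_
      · rw [vertexSet_part hT.vertexSet_eq]; rfl
      · rw [vertexSet_part hT.vertexSet_eq]; exact huv.symm
    have hR : ∀ u, u ∩ R ∩ R = u ∩ R := fun u => by rw [Finset.inter_assoc, Finset.inter_self]
    refine hpart _ _ (hR y) (hcconn P ?_ (x ∩ R) ?_ (y ∩ R) ?_ (hpart _ _ (hR x).symm hPx))
    · intro e a b hab ha
      obtain ⟨u, v, huv, rfl, rfl, -⟩ := (contract_isLink hT.le).1 hab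
      exact hpart _ _ (hR v).symm (hP e u v huv (hpart _ _ (hR u) ha))
    · rw [vertexSet_contract hT.vertexSet_eq]; exact Finset.inter_subset_right
    · rw [vertexSet_contract hT.vertexSet_eq]; exact Finset.inter_subset_right
  · have h1 := ncard_edgeSet hT.le R
    have h2 : ∀ X : {X : Finset (Fin n) // X ⊆ R},
        (part T R X.1).edgeSet.ncard + 1 = 2 ^ (n - R.card) := fun X => by
      rw [((isTree_iff _).1 (hp X.1 X.2)).2.2, vertexSet_part hT.vertexSet_eq,
        ncard_setOf_inter_eq X.2]
    have h3 := Finset.sum_congr (rfl : (Finset.univ : Finset {X : Finset (Fin n) // X ⊆ R}) = _)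
      fun X _ => h2 X
    rw [Finset.sum_add_distrib, Finset.sum_const, Finset.sum_const, Finset.card_univ,
      card_subtype_subset, smul_eq_mul, smul_eq_mul, two_pow_mul_two_pow_sub] at h3
    rw [hT.vertexSet_eq, vertexSet_cube, Set.ncard_univ, Nat.card_eq_fintype_card,
      Fintype.card_finset, Fintype.card_fin]
    omega

theorem mem_verts_edgeSlideSigs {𝒳 : Set (Fin n → ℕ)} {T : SpanningTree (cube n)} :
    T ∈ (edgeSlideSigs 𝒳).verts ↔ signature T.1 ∈ 𝒳 := by
  simp [edgeSlideSigs, edgeSlideSig]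

theorem mem_verts_red {T : SpanningTree (cube n)} :
    T ∈ (edgeSlideSigs (red R)).verts ↔ ReducesOver (signature T.1) R := by
  rw [mem_verts_edgeSlideSigs]
  simp only [red, Set.mem_ofPred_eq]
  exact and_iff_right ⟨T, rfl⟩

theorem IsEdgeSlide.signature_eq {T₁ T₂ : Graph (Finset (Fin n)) (Sym2 (Finset (Fin n)))}
    (h : IsEdgeSlide T₁ T₂) : signature T₁ = signature T₂ := by
  obtain ⟨e, i, j, he, hj, -, hs, hT⟩ := h
  funext k
  simp only [signature, hT]
  by_cases hk : k = j
  · subst hk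
    have : {f | f ∈ insert (EdgeSlide.slide i e) (T₁.edgeSet \ {e}) ∧ HasDirection f k} =
        insert (EdgeSlide.slide i e) ({f | f ∈ T₁.edgeSet ∧ HasDirection f k} \ {e}) := by
      ext f
      simp only [Set.mem_ofPred_eq, Set.mem_insert_iff, Set.mem_sdiff, Set.mem_singleton_iff]
      constructor
      · rintro ⟨rfl | h, h'⟩
        · exact Or.inl rfl
        · exact Or.inr ⟨⟨h.1, h'⟩, h.2⟩
      · rintro (rfl | h)
        · exact ⟨Or.inl rfl, hj.slide i⟩
        · exact ⟨Or.inr ⟨h.1.1, h.2⟩, h.1.2⟩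
    have he' : e ∈ {f | f ∈ T₁.edgeSet ∧ HasDirection f k} := ⟨he, hj⟩
    have hs' : EdgeSlide.slide i e ∉ {f | f ∈ T₁.edgeSet ∧ HasDirection f k} := fun h => hs h.1
    rw [this, Set.ncard_exchange hs' he']
  · congr 1
    ext f
    simp only [Set.mem_ofPred_eq, Set.mem_insert_iff, Set.mem_sdiff, Set.mem_singleton_iff]
    constructor
    · rintro ⟨h, h'⟩
      exact ⟨Or.inr ⟨h, by rintro rfl; exact hk (h'.unique hj)⟩, h'⟩
    · rintro ⟨rfl | h, h'⟩
      · exact absurd (h'.unique (hj.slide i)) hk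
      · exact ⟨h.1, h'⟩

/-- The union of the graphs of single signatures loses no slide, as slides preserve the signature.
-/
theorem edgeSlideSigs_adj {𝒳 : Set (Fin n → ℕ)} {T₁ T₂ : SpanningTree (cube n)}
    (h : T₁ ∈ (edgeSlideSigs 𝒳).verts) :
    (edgeSlideSigs 𝒳).Adj T₁ T₂ ↔ IsEdgeSlide T₁.1 T₂.1 := by
  rw [mem_verts_edgeSlideSigs] at h
  simp only [edgeSlideSigs, edgeSlideSig, SimpleGraph.Subgraph.iSup_adj,
    SimpleGraph.Subgraph.induce_adj, SimpleGraph.Subgraph.top_adj]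
  constructor
  · rintro ⟨S, -, -, -, h⟩
    exact h
  · intro h'
    exact ⟨_, h, rfl, h'.signature_eq.symm, h'⟩

end Decomposition

/-! ### Slides act in one block at a time -/

section Isomorphism

variable {n : ℕ} {R : Finset (Fin n)}

/-- The edges of the decomposition of the cube into the contraction and the parts are slid
independently, provided that the number of edges in each block is the same before and after. -/
theorem isEdgeSlide_iff_exists_block {T₁ T₂ : Graph (Finset (Fin n)) (Sym2 (Finset (Fin n)))}
    (h₁ : T₁ ≤ cube n) (h₂ : T₂ ≤ cube n)
    (hcard : ∀ o, (T₁.edgeSet ∩ block R o).ncard = (T₂.edgeSet ∩ block R o).ncard) :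
    IsEdgeSlide T₁ T₂ ↔ ∃ o, IsEdgeSlide (T₁.restrict (block R o)) (T₂.restrict (block R o)) ∧
      ∀ o', o' ≠ o → T₁.edgeSet ∩ block R o' = T₂.edgeSet ∩ block R o' := by
  constructor
  · rintro ⟨e, i, j, he, hj, hij, hs, hT⟩
    obtain ⟨o, ho⟩ := exists_mem_block R (h₁.edgeSet_mono he)
    obtain ⟨o', ho'⟩ := exists_mem_block R (h₂.edgeSet_mono (hT ▸ Set.mem_insert _ _))
    -- If the edge landed in another block, block `o` would lose `e` and gain nothing, against
    -- `hcard`.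
    have hoo : o' = o := by
      by_contra hne
      have hB : T₂.edgeSet ∩ block R o = (T₁.edgeSet ∩ block R o) \ {e} := by
        ext f
        simp only [hT, Set.mem_inter_iff, Set.mem_insert_iff, Set.mem_sdiff,
          Set.mem_singleton_iff]
        constructor
        · rintro ⟨rfl | h, hf⟩
          · exact absurd (block_unique _ _ ho' hf) hne
          · exact ⟨⟨h.1, hf⟩, h.2⟩
        · rintro ⟨⟨h, hf⟩, h'⟩
          exact ⟨Or.inr ⟨h, h'⟩, hf⟩
      have heo : e ∈ T₁.edgeSet ∩ block R o := ⟨he, ho⟩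
      have := Set.ncard_sdiff_singleton_lt_of_mem heo
      rw [← hB, hcard] at this
      exact lt_irrefl _ this
    subst hoo
    refine ⟨o', ⟨e, i, j, ⟨he, ho⟩, hj, hij, fun h => hs h.1, ?_⟩, fun o hne => ?_⟩
    · ext f
      simp only [Graph.edgeSet_restrict, hT, Set.mem_inter_iff, Set.mem_insert_iff, Set.mem_sdiff,
        Set.mem_singleton_iff]
      constructor
      · rintro ⟨h | h, hf⟩
        · exact Or.inl h
        · exact Or.inr ⟨⟨h.1, hf⟩, h.2⟩
      · rintro (rfl | h)
        · exact ⟨Or.inl rfl, ho'⟩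
        · exact ⟨Or.inr ⟨h.1.1, h.2⟩, h.1.2⟩
    · ext f
      simp only [hT, Set.mem_inter_iff, Set.mem_insert_iff, Set.mem_sdiff, Set.mem_singleton_iff]
      constructor
      · rintro ⟨h, hf⟩
        exact ⟨Or.inr ⟨h, by rintro rfl; exact hne (block_unique _ _ hf ho)⟩, hf⟩
      · rintro ⟨rfl | h, hf⟩
        · exact absurd (block_unique _ _ hf ho') hne
        · exact ⟨h.1, hf⟩
  · rintro ⟨o, ⟨e, i, j, he, hj, hij, hs, hT⟩, ho⟩
    simp only [Graph.edgeSet_restrict] at he hs hT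
    have hse : slide i e ∈ T₂.edgeSet ∩ block R o := hT ▸ Set.mem_insert _ _
    refine ⟨e, i, j, he.1, hj, hij, fun h => hs ⟨h, hse.2⟩, ?_⟩
    rw [eq_iff_forall_block R h₂.edgeSet_mono
      (Set.insert_subset (h₂.edgeSet_mono hse.1) (Set.sdiff_subset.trans h₁.edgeSet_mono))]
    intro o'
    by_cases hoo : o' = o
    · subst hoo
      rw [hT]
      ext f
      simp only [Set.mem_inter_iff, Set.mem_insert_iff, Set.mem_sdiff, Set.mem_singleton_iff]
      constructor
      · rintro (rfl | h)
        · exact ⟨Or.inl rfl, hse.2⟩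
        · exact ⟨Or.inr ⟨h.1.1, h.2⟩, h.1.2⟩
      · rintro ⟨h | h, hf⟩
        · exact Or.inl h
        · exact Or.inr ⟨⟨h.1, hf⟩, h.2⟩
    · rw [← ho o' hoo]
      ext f
      simp only [Set.mem_inter_iff, Set.mem_insert_iff, Set.mem_sdiff, Set.mem_singleton_iff]
      constructor
      · rintro ⟨h, hf⟩
        exact ⟨Or.inr ⟨h, by rintro rfl; exact hoo (block_unique _ _ hf he.2)⟩, hf⟩
      · rintro ⟨rfl | h, hf⟩
        · exact absurd (block_unique _ _ hf hse.2) hoo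
        · exact ⟨h.1, hf⟩

theorem IsEdgeSlide.congr {T₁ T₂ T₁' T₂' : Graph (Finset (Fin n)) (Sym2 (Finset (Fin n)))}
    (h₁ : T₁.edgeSet = T₁'.edgeSet) (h₂ : T₂.edgeSet = T₂'.edgeSet) :
    IsEdgeSlide T₁ T₂ ↔ IsEdgeSlide T₁' T₂' := by
  simp only [IsEdgeSlide, h₁, h₂]

/-- The contraction and the parts of a spanning tree of the cube that reduces over `R`. -/
noncomputable def decompose (R : Finset (Fin n)) (T : (edgeSlideSigs (red R)).verts) :
    SpanningTree (contract (cube n) Rᶜ) ×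
      ∀ X : {X : Finset (Fin n) // X ⊆ R}, SpanningTree (part (cube n) R X.1) :=
  (⟨contract T.1.1 Rᶜ, contract_isSpanningSubgraph T.1.2.1 R,
      isTree_contract T.1.2 (mem_verts_red.1 T.2)⟩,
    fun X => ⟨part T.1.1 R X.1, part_isSpanningSubgraph T.1.2.1 R X.1,
      isTree_part T.1.2 (mem_verts_red.1 T.2) X.2⟩)

theorem decompose_injective (R : Finset (Fin n)) : Function.Injective (decompose R) := by
  intro T₁ T₂ h
  refine Subtype.ext (SpanningTree.ext_edgeSet
    ((eq_iff_forall_block R T₁.1.2.1.le.edgeSet_mono T₂.1.2.1.le.edgeSet_mono).2 ?_))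
  rintro (_ | X)
  · have := congrArg (fun p => p.1.1.edgeSet) h
    simpa only [decompose, block, edgeSet_contract_eq_inter T₁.1.2.1.le,
      edgeSet_contract_eq_inter T₂.1.2.1.le] using this
  · have := congrArg (fun p => (p.2 X).1.edgeSet) h
    simpa only [decompose, block, edgeSet_part T₁.1.2.1.le, edgeSet_part T₂.1.2.1.le] using this

theorem decompose_surjective (R : Finset (Fin n)) : Function.Surjective (decompose R) := by
  rintro ⟨C, f⟩
  set F : Option {X : Finset (Fin n) // X ⊆ R} → Set (Sym2 (Finset (Fin n))) :=
    fun o => o.elim C.1.edgeSet fun X => (f X).1.edgeSet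
  have hF : ∀ o, F o ⊆ block R o := by
    rintro (_ | X)
    · exact C.2.1.le.edgeSet_mono
    · exact (f X).2.1.le.edgeSet_mono
  have hcube : ∀ o, block R o ⊆ (cube n).edgeSet := by
    rintro (_ | X)
    · exact edgeSet_contract_subset R
    · exact edgeSet_part_subset R X.1
  set T := (cube n).restrict (⋃ o, F o)
  have hT : T.IsSpanningSubgraph (cube n) := restrict_isSpanningSubgraph _ _
  -- Disjointness of the blocks ensures that the union of the chosen trees meets each block in the
  -- chosen tree only.
  have hblock : ∀ o, T.edgeSet ∩ block R o = F o := by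
    intro o
    ext e
    simp only [T, Graph.edgeSet_restrict, Set.mem_inter_iff, Set.mem_iUnion]
    constructor
    · rintro ⟨⟨-, o', ho'⟩, ho⟩
      exact block_unique _ _ (hF _ ho') ho ▸ ho'
    · exact fun he => ⟨⟨hcube o (hF o he), o, he⟩, hF o he⟩
  have hC : contract T Rᶜ = C.1 := eq_of_isSpanningSubgraph (contract_isSpanningSubgraph hT R)
    C.2.1 ((edgeSet_contract_eq_inter hT.le R).trans (hblock none))
  have hf : ∀ X : {X : Finset (Fin n) // X ⊆ R}, part T R X.1 = (f X).1 := fun X =>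
    eq_of_isSpanningSubgraph (part_isSpanningSubgraph hT R X.1)
      (f X).2.1 ((edgeSet_part hT.le R X.1).trans (hblock (some X)))
  obtain ⟨htree, hred⟩ := isTree_of_contract_of_part (R := R) hT (hC ▸ C.2.2)
    fun X hX => hf ⟨X, hX⟩ ▸ (f ⟨X, hX⟩).2.2
  exact ⟨⟨⟨T, hT, htree⟩, mem_verts_red.2 hred⟩,
    Prod.ext (Subtype.ext hC) (funext fun X => Subtype.ext (hf X))⟩

/-- In each block both trees span the same vertex set, which fixes their number of edges. -/
theorem ncard_inter_block_eq (T₁ T₂ : (edgeSlideSigs (red R)).verts) (o) :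
    (T₁.1.1.edgeSet ∩ block R o).ncard = (T₂.1.1.edgeSet ∩ block R o).ncard := by
  rcases o with _ | X
  · have h1 := ((isTree_iff _).1 (decompose R T₁).1.2.2).2.2
    have h2 := ((isTree_iff _).1 (decompose R T₂).1.2.2).2.2
    rw [(decompose R T₁).1.2.1.vertexSet_eq] at h1
    rw [(decompose R T₂).1.2.1.vertexSet_eq, ← h1, add_left_inj] at h2
    simpa only [decompose, block, edgeSet_contract_eq_inter T₁.1.2.1.le,
      edgeSet_contract_eq_inter T₂.1.2.1.le] using h2.symm
  · have h1 := ((isTree_iff _).1 ((decompose R T₁).2 X).2.2).2.2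
    have h2 := ((isTree_iff _).1 ((decompose R T₂).2 X).2.2).2.2
    rw [((decompose R T₁).2 X).2.1.vertexSet_eq] at h1
    rw [((decompose R T₂).2 X).2.1.vertexSet_eq, ← h1, add_left_inj] at h2
    simpa only [decompose, block, edgeSet_part T₁.1.2.1.le,
      edgeSet_part T₂.1.2.1.le] using h2.symm

theorem boxProd_adj_decompose_iff (T₁ T₂ : (edgeSlideSigs (red R)).verts) :
    ((edgeSlideGraph (contract (cube n) Rᶜ)).boxProd
      (boxPi fun X : {X : Finset (Fin n) // X ⊆ R} => edgeSlideGraph (part (cube n) R X.1))).Adj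
        (decompose R T₁) (decompose R T₂) ↔ (edgeSlideSigs (red R)).coe.Adj T₁ T₂ := by
  have hc : ∀ T : (edgeSlideSigs (red R)).verts,
      (decompose R T).1.1.edgeSet = T.1.1.edgeSet ∩ block R none :=
    fun T => edgeSet_contract_eq_inter T.1.2.1.le R
  have hp : ∀ (T : (edgeSlideSigs (red R)).verts) (X : {X : Finset (Fin n) // X ⊆ R}),
      ((decompose R T).2 X).1.edgeSet = T.1.1.edgeSet ∩ block R (some X) :=
    fun T X => edgeSet_part T.1.2.1.le R X.1
  have hc' : (decompose R T₁).1 = (decompose R T₂).1 ↔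
      T₁.1.1.edgeSet ∩ block R none = T₂.1.1.edgeSet ∩ block R none := by
    rw [← hc, ← hc]
    exact ⟨fun h => h ▸ rfl, SpanningTree.ext_edgeSet⟩
  have hp' : ∀ X, (decompose R T₁).2 X = (decompose R T₂).2 X ↔
      T₁.1.1.edgeSet ∩ block R (some X) = T₂.1.1.edgeSet ∩ block R (some X) := by
    intro X
    rw [← hp, ← hp]
    exact ⟨fun h => h ▸ rfl, SpanningTree.ext_edgeSet⟩
  rw [SimpleGraph.Subgraph.coe_adj, edgeSlideSigs_adj T₁.2, isEdgeSlide_iff_exists_block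
    T₁.1.2.1.le T₂.1.2.1.le (ncard_inter_block_eq T₁ T₂), Option.exists,
    SimpleGraph.boxProd_adj]
  -- The block `none` gives the first alternative of the box product, the blocks `some X` the
  -- second.
  refine or_congr (and_congr (IsEdgeSlide.congr (hc T₁) (hc T₂)) ?_) ?_
  · simp [Option.forall, funext_iff, hp']
  · simp only [boxPi, hc', hp', Option.forall, ne_eq, Option.some.injEq,
      reduceCtorEq, not_false_eq_true, true_implies]
    rw [← exists_and_right]
    refine exists_congr fun X => ?_
    rw [and_assoc, and_comm (a := ∀ _, _)]
    exact and_congr_left' (IsEdgeSlide.congr (hp T₁ X) (hp T₂ X))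

/-- The spanning trees that reduce over `R` as a product of edge slide graphs. -/
noncomputable def decomposeIso (R : Finset (Fin n)) : (edgeSlideSigs (red R)).coe ≃g
    (edgeSlideGraph (contract (cube n) Rᶜ)).boxProd
      (boxPi fun X : {X : Finset (Fin n) // X ⊆ R} => edgeSlideGraph (part (cube n) R X.1)) where
  toEquiv := Equiv.ofBijective _ ⟨decompose_injective R, decompose_surjective R⟩
  map_rel_iff' := boxProd_adj_decompose_iff _ _

end Isomorphism

/-! ### Each part is a copy of a smaller cube -/

section PartIso

variable {m n : ℕ} (ι : Fin m ↪ Fin n) (X : Finset (Fin n))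

/-- The embedding of a smaller cube with base point `X` and directions `ι`. -/
def subcube (A : Finset (Fin m)) : Finset (Fin n) := X ∆ A.map ι

theorem subcube_symmDiff (A B : Finset (Fin m)) :
    subcube ι X A ∆ subcube ι X B = (A ∆ B).map ι := by
  rw [subcube, subcube, symmDiff_symmDiff_symmDiff_comm, symmDiff_self, bot_symmDiff]
  simp only [Finset.map_eq_image, Finset.image_symmDiff _ _ ι.injective]

theorem subcube_symmDiff_singleton (A : Finset (Fin m)) (i : Fin m) :
    subcube ι X (A ∆ {i}) = subcube ι X A ∆ {ι i} := by
  rw [subcube, subcube, symmDiff_assoc]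
  simp only [Finset.map_eq_image, Finset.image_symmDiff _ _ ι.injective, Finset.image_singleton]

theorem subcube_injective : Function.Injective (subcube ι X) :=
  (symmDiff_right_injective X).comp (Finset.map_injective ι)

theorem map_slide (i : Fin m) (e : Sym2 (Finset (Fin m))) :
    (slide i e).map (subcube ι X) = slide (ι i) (e.map (subcube ι X)) := by
  induction e with
  | h A B => simp [slide, subcube_symmDiff_singleton]

theorem HasDirection.map {e : Sym2 (Finset (Fin m))} {i : Fin m} (h : HasDirection e i) :
    HasDirection (e.map (subcube ι X)) (ι i) := by
  obtain ⟨A, rfl⟩ := h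
  exact ⟨subcube ι X A, by simp [subcube_symmDiff_singleton]⟩

variable {ι X} {R : Finset (Fin n)}

theorem subcube_inter (hι : ∀ i, i ∈ Set.range ι ↔ i ∉ R) (hX : X ⊆ R) (A : Finset (Fin m)) :
    subcube ι X A ∩ R = X := by
  ext k
  have h1 := @hX k
  simp only [subcube, Finset.mem_inter, Finset.mem_symmDiff, Finset.mem_map]
  have h2 : k ∈ R → ¬ ∃ a ∈ A, ι a = k := fun hk ⟨a, _, ha⟩ => (hι k).1 ⟨a, ha⟩ hk
  generalize (∃ a ∈ A, ι a = k) = q at h2 ⊢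
  tauto

theorem range_subcube (hι : ∀ i, i ∈ Set.range ι ↔ i ∉ R) (hX : X ⊆ R) :
    Set.range (subcube ι X) = {W | W ∩ R = X} := by
  ext W
  constructor
  · rintro ⟨A, rfl⟩
    exact subcube_inter hι hX A
  · rintro rfl
    refine ⟨Finset.univ.filter fun a => ι a ∈ W, ?_⟩
    ext k
    have h2 : (∃ a, ι a ∈ W ∧ ι a = k) ↔ k ∈ W ∧ k ∉ R := by
      rw [← hι]
      exact ⟨fun ⟨a, h, h'⟩ => ⟨h' ▸ h, a, h'⟩, fun ⟨h, a, h'⟩ => ⟨a, h' ▸ h, h'⟩⟩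
    simp only [subcube, Finset.mem_inter, Finset.mem_symmDiff, Finset.mem_map, Finset.mem_filter,
      Finset.mem_univ, true_and, h2]
    tauto

theorem part_isLink_subcube (hι : ∀ i, i ∈ Set.range ι ↔ i ∉ R) (hX : X ⊆ R)
    {e : Sym2 (Finset (Fin m))} {A B : Finset (Fin m)} :
    (part (cube n) R X).IsLink (e.map (subcube ι X)) (subcube ι X A) (subcube ι X B) ↔
      (cube m).IsLink e A B := by
  rw [part_isLink, cube_isLink, cube_isLink, subcube_symmDiff, ← Sym2.map_mk,
    (Sym2.map.injective (subcube_injective ι X)).eq_iff]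
  constructor
  · rintro ⟨⟨h, k, hk⟩, -⟩
    obtain ⟨a, ha, rfl⟩ := Finset.mem_map.1 (hk ▸ Finset.mem_singleton_self k)
    exact ⟨h, a, Finset.map_injective ι (by rw [hk, Finset.map_singleton])⟩
  · rintro ⟨h, a, ha⟩
    exact ⟨⟨h, ι a, by rw [ha, Finset.map_singleton]⟩, subcube_inter hι hX A,
      subcube_inter hι hX B⟩

theorem exists_eq_map_subcube (hι : ∀ i, i ∈ Set.range ι ↔ i ∉ R) (hX : X ⊆ R)
    {e : Sym2 (Finset (Fin n))} {x y : Finset (Fin n)} (h : (part (cube n) R X).IsLink e x y) :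
    ∃ A B, x = subcube ι X A ∧ y = subcube ι X B ∧ e = s(A, B).map (subcube ι X) := by
  rw [part_isLink] at h
  obtain ⟨A, rfl⟩ : x ∈ Set.range (subcube ι X) := by rw [range_subcube hι hX]; exact h.2.1
  obtain ⟨B, rfl⟩ : y ∈ Set.range (subcube ι X) := by rw [range_subcube hι hX]; exact h.2.2
  exact ⟨A, B, rfl, rfl, (cube_isLink.1 h.1).1⟩

theorem edgeSet_part_cube (hι : ∀ i, i ∈ Set.range ι ↔ i ∉ R) (hX : X ⊆ R) :
    (part (cube n) R X).edgeSet = Sym2.map (subcube ι X) '' (cube m).edgeSet := by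
  ext e
  constructor
  · intro he
    obtain ⟨x, y, h⟩ := Graph.exists_isLink_of_mem_edgeSet he
    obtain ⟨A, B, rfl, rfl, rfl⟩ := exists_eq_map_subcube hι hX h
    exact ⟨_, ((part_isLink_subcube hι hX).1 h).edge_mem, rfl⟩
  · rintro ⟨e, he, rfl⟩
    obtain ⟨A, B, h⟩ := Graph.exists_isLink_of_mem_edgeSet he
    exact ((part_isLink_subcube hι hX).2 h).edge_mem

theorem isConn_restrict_part_iff (hι : ∀ i, i ∈ Set.range ι ↔ i ∉ R) (hX : X ⊆ R)
    (F : Set (Sym2 (Finset (Fin m)))) :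
    IsConn ((part (cube n) R X).restrict (Sym2.map (subcube ι X) '' F)) ↔
      IsConn ((cube m).restrict F) := by
  have hV : (part (cube n) R X).vertexSet = Set.range (subcube ι X) := by
    rw [vertexSet_part rfl, range_subcube hι hX]
  have hinj := Sym2.map.injective (subcube_injective ι X)
  constructor
  · intro h P hP A _ B _ hA
    -- `P` is pushed forward along `subcube ι X`; injectivity recovers it at `B`.
    have := h (fun W => ∃ C, W = subcube ι X C ∧ P C) ?_ (subcube ι X A) (hV.superset ⟨A, rfl⟩)
      (subcube ι X B) (hV.superset ⟨B, rfl⟩) ⟨A, rfl, hA⟩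
    · obtain ⟨C, hC, hPC⟩ := this
      exact subcube_injective ι X hC ▸ hPC
    · rintro e _ y ⟨heF, he⟩ ⟨C, rfl, hC⟩
      obtain ⟨A, B, hA, rfl, rfl⟩ := exists_eq_map_subcube hι hX he
      refine ⟨B, rfl, hP s(A, B) C B ⟨?_, (part_isLink_subcube hι hX).1 he⟩ hC⟩
      exact hinj.mem_set_image.1 heF
  · intro h P hP x hx y hy
    obtain ⟨A, rfl⟩ := hV.subset hx
    obtain ⟨B, rfl⟩ := hV.subset hy
    exact h (fun C => P (subcube ι X C)) (fun e C D hCD => hP (e.map (subcube ι X)) _ _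
      ⟨⟨e, hCD.1, rfl⟩, (part_isLink_subcube hι hX).2 hCD.2⟩) A trivial B trivial

theorem isTree_restrict_part_iff (hι : ∀ i, i ∈ Set.range ι ↔ i ∉ R) (hX : X ⊆ R)
    (F : Set (Sym2 (Finset (Fin m)))) :
    IsTree ((part (cube n) R X).restrict (Sym2.map (subcube ι X) '' F)) ↔
      IsTree ((cube m).restrict F) := by
  have hinj := Sym2.map.injective (subcube_injective ι X)
  rw [isTree_iff, isTree_iff, isConn_restrict_part_iff hι hX, Graph.edgeSet_restrict,
    Graph.edgeSet_restrict, edgeSet_part_cube hι hX, ← Set.image_inter hinj,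
    Set.ncard_image_of_injective _ hinj, Graph.vertexSet_restrict, Graph.vertexSet_restrict,
    vertexSet_part rfl, ← range_subcube hι hX, ← Set.image_univ,
    Set.ncard_image_of_injective _ (subcube_injective ι X), Set.image_nonempty, vertexSet_cube]

/-- The spanning tree of a part that corresponds to a spanning tree of the smaller cube. -/
def mapTree (hι : ∀ i, i ∈ Set.range ι ↔ i ∉ R) (hX : X ⊆ R) (T : SpanningTree (cube m)) :
    SpanningTree (part (cube n) R X) :=
  ⟨(part (cube n) R X).restrict (Sym2.map (subcube ι X) '' T.1.edgeSet),
    restrict_isSpanningSubgraph _ _, (isTree_restrict_part_iff hι hX _).2 (by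
      rw [eq_of_isSpanningSubgraph (restrict_isSpanningSubgraph _ _) T.2.1 (by
        rw [Graph.edgeSet_restrict]; exact Set.inter_eq_right.2 T.2.1.le.edgeSet_mono)]
      exact T.2.2)⟩

theorem edgeSet_mapTree (hι : ∀ i, i ∈ Set.range ι ↔ i ∉ R) (hX : X ⊆ R)
    (T : SpanningTree (cube m)) :
    (mapTree hι hX T).1.edgeSet = Sym2.map (subcube ι X) '' T.1.edgeSet := by
  rw [mapTree, Graph.edgeSet_restrict, edgeSet_part_cube hι hX]
  exact Set.inter_eq_right.2 (Set.image_mono T.2.1.le.edgeSet_mono)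

theorem mapTree_bijective (hι : ∀ i, i ∈ Set.range ι ↔ i ∉ R) (hX : X ⊆ R) :
    Function.Bijective (mapTree hι hX) := by
  have hinj := Sym2.map.injective (subcube_injective ι X)
  constructor
  · intro T₁ T₂ h
    have := congrArg (fun T => T.1.edgeSet) h
    simp only [edgeSet_mapTree] at this
    exact SpanningTree.ext_edgeSet (hinj.image_injective this)
  · intro T
    have hF : Sym2.map (subcube ι X) '' (Sym2.map (subcube ι X) ⁻¹' T.1.edgeSet) =
        T.1.edgeSet := by
      refine Set.image_preimage_eq_of_subset (T.2.1.le.edgeSet_mono.trans ?_)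
      rw [edgeSet_part_cube hι hX]
      exact Set.image_subset_range _ _
    have hT : (part (cube n) R X).restrict T.1.edgeSet = T.1 :=
      eq_of_isSpanningSubgraph (restrict_isSpanningSubgraph _ _) T.2.1 (by
        rw [Graph.edgeSet_restrict]; exact Set.inter_eq_right.2 T.2.1.le.edgeSet_mono)
    refine ⟨⟨(cube m).restrict (Sym2.map (subcube ι X) ⁻¹' T.1.edgeSet),
      restrict_isSpanningSubgraph _ _, ?_⟩, SpanningTree.ext_edgeSet ?_⟩
    · rw [← isTree_restrict_part_iff hι hX, hF, hT]
      exact T.2.2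
    · rw [edgeSet_mapTree, Graph.edgeSet_restrict, Set.image_inter hinj,
        ← edgeSet_part_cube hι hX, hF]
      exact Set.inter_eq_right.2 T.2.1.le.edgeSet_mono

theorem isEdgeSlide_mapTree_iff (hι : ∀ i, i ∈ Set.range ι ↔ i ∉ R) (hX : X ⊆ R)
    (T₁ T₂ : SpanningTree (cube m)) :
    IsEdgeSlide (mapTree hι hX T₁).1 (mapTree hι hX T₂).1 ↔ IsEdgeSlide T₁.1 T₂.1 := by
  have hinj := Sym2.map.injective (subcube_injective ι X)
  have key : ∀ (e : Sym2 (Finset (Fin m))) (i : Fin m),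
      Sym2.map (subcube ι X) '' (insert (slide i e) (T₁.1.edgeSet \ {e})) =
      insert (slide (ι i) (e.map (subcube ι X)))
        (Sym2.map (subcube ι X) '' T₁.1.edgeSet \ {e.map (subcube ι X)}) := by
    intro e i
    rw [Set.image_insert_eq, Set.image_sdiff hinj, Set.image_singleton, map_slide]
  constructor
  · rintro ⟨_, k, l, he, hl, hkl, hs, hT⟩
    rw [edgeSet_mapTree] at he hs
    obtain ⟨e, he, rfl⟩ := he
    obtain ⟨j, hj⟩ := mem_edgeSet_cube.1 (T₁.2.1.le.edgeSet_mono he)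
    obtain rfl := (hj.map ι X).unique hl
    -- A slide in a part may use any direction of `[n]`, but one in `R` would change the trace on
    -- `R` and take the edge out of the part.
    have hk : k ∉ R := by
      intro hk
      have hmem := (mapTree hι hX T₂).2.1.le.edgeSet_mono (hT ▸ Set.mem_insert _ _)
      rw [edgeSet_part_cube hι hX] at hmem
      obtain ⟨e', -, he'⟩ := hmem
      induction e with
      | h A B =>
      induction e' with
      | h C D =>
      simp only [slide, Sym2.map_mk] at he'
      have hA : ∀ E, subcube ι X E ≠ subcube ι X A ∆ {k} := by
        intro E hE
        have h1 := congrArg (k ∈ ·) (subcube_inter hι hX A)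
        have h2 := congrArg (k ∈ ·) (subcube_inter hι hX E)
        simp only [hE, Finset.mem_inter, Finset.mem_symmDiff, Finset.mem_singleton, hk,
          eq_iff_iff] at h1 h2
        tauto
      rcases Sym2.eq_iff.1 he' with h | h
      · exact hA _ h.1
      · exact hA _ h.2
    obtain ⟨i, rfl⟩ := (hι k).2 hk
    refine ⟨e, i, j, he, hj, fun h => hkl (congrArg ι h), ?_, hinj.image_injective ?_⟩
    · rwa [← map_slide, hinj.mem_set_image] at hs
    · rw [key, ← edgeSet_mapTree hι hX, ← edgeSet_mapTree hι hX]
      exact hT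
  · rintro ⟨e, i, j, he, hj, hij, hs, hT⟩
    refine ⟨e.map (subcube ι X), ι i, ι j, ?_, hj.map ι X, ι.injective.ne hij, ?_, ?_⟩
    · rw [edgeSet_mapTree]; exact ⟨e, he, rfl⟩
    · rwa [edgeSet_mapTree, ← map_slide, hinj.mem_set_image]
    · rw [edgeSet_mapTree, edgeSet_mapTree, hT, key]

theorem nonempty_partIso (R : Finset (Fin n)) {X : Finset (Fin n)} (hX : X ⊆ R) :
    Nonempty (edgeSlideGraph (part (cube n) R X) ≃g edgeSlideGraph (cube (n - R.card))) := by
  have hcard : Rᶜ.card = n - R.card := by rw [Finset.card_compl, Fintype.card_fin]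
  -- The directions of the small cube are those outside `R`, enumerated in increasing order.
  have hι : ∀ i, i ∈ Set.range (Rᶜ.orderEmbOfFin hcard).toEmbedding ↔ i ∉ R := by
    intro i
    simp
  exact ⟨SimpleGraph.Iso.symm
    { toEquiv := Equiv.ofBijective _ (mapTree_bijective hι hX)
      map_rel_iff' := isEdgeSlide_mapTree_iff hι hX _ _ }⟩

end PartIso

/-! ### Isomorphisms of Cartesian products -/

section Products

/-- Products of isomorphic families of graphs are isomorphic. -/
def boxPiCongr {ι κ : Type*} {V : ι → Type*} {W : Type*} {G : ∀ i, SimpleGraph (V i)}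
    {H : SimpleGraph W} (ε : ι ≃ κ) (ψ : ∀ i, G i ≃g H) :
    boxPi G ≃g boxPi fun _ : κ => H where
  toEquiv := (Equiv.piCongrRight fun i => (ψ i).toEquiv).trans (ε.arrowCongr (Equiv.refl W))
  map_rel_iff' := by
    intro f g
    simp only [boxPi, ε.exists_congr_left, ε.forall_congr_left]
    simp only [Equiv.trans_apply, Equiv.piCongrRight_apply, Equiv.arrowCongr_apply,
      Function.comp_apply, Pi.map_apply, EmbeddingLike.apply_eq_iff_eq, ne_eq,
      Equiv.coe_refl, id_eq]
    exact exists_congr fun k => and_congr_left' (ψ (ε.symm k)).map_adj_iff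

/-- The product of a fixed graph with isomorphic graphs. -/
def boxProdCongrRight {U V W : Type*} (F : SimpleGraph U) {G : SimpleGraph V} {H : SimpleGraph W}
    (ψ : G ≃g H) : F.boxProd G ≃g F.boxProd H where
  toEquiv := (Equiv.refl U).prodCongr ψ.toEquiv
  map_rel_iff' := by
    intro f g
    simp only [SimpleGraph.boxProd_adj, Equiv.prodCongr_apply, Prod.map_fst, Prod.map_snd,
      Equiv.refl_apply, EmbeddingLike.apply_eq_iff_eq]
    exact or_congr_right (and_congr_left' ψ.map_adj_iff)

end Products

end EdgeSlide

open EdgeSlide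
theorem theorem6p5 (n : ℕ) (R : Finset (Fin n)) (hne : R.Nonempty) (hproper : R ≠ Finset.univ) :
    (∃ Φ : (edgeSlideSigs (red R)).coe ≃g
        (edgeSlideGraph (contract (cube n) Rᶜ)).boxProd
          (boxPi fun X : {X : Finset (Fin n) // X ⊆ R} => edgeSlideGraph (part (cube n) R X.1)),
      ∀ T : (edgeSlideSigs (red R)).verts,
        (Φ T).1.1 = contract T.1.1 Rᶜ ∧
        ∀ X : {X : Finset (Fin n) // X ⊆ R}, ((Φ T).2 X).1 = part T.1.1 R X.1) ∧
    Nonempty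
      ((edgeSlideGraph (contract (cube n) Rᶜ)).boxProd
          (boxPi fun X : {X : Finset (Fin n) // X ⊆ R} => edgeSlideGraph (part (cube n) R X.1)) ≃g
        (edgeSlideGraph (contract (cube n) Rᶜ)).boxProd
          (boxPi fun _ : Fin (2 ^ R.card) => edgeSlideGraph (cube (n - R.card)))) := by
  refine ⟨⟨decomposeIso R, fun T => ⟨rfl, fun X => rfl⟩⟩, ⟨boxProdCongrRight _ ?_⟩⟩
  exact boxPiCongr (Fintype.equivFinOfCardEq (card_subtype_subset R))
    fun X => Classical.choice (nonempty_partIso R X.2)
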